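/- Let $U_q=U_q(\mathfrak{sl}_2)$ be the $\mathbb{Q}(q)$-algebra with generators $e,f,t^{\pm1}$ and relations $tt^{-1}=t^{-1}t=1$, $tet^{-1}=q^2e$, $tft^{-1}=q^{-2}f$, $ef-fe=\frac{t-t^{-1}}{q-q^{-1}}$; let $U_q^-$ be the subalgebra generated by $f$, and let $\mathcal{B}_q$ be Kashiwara's $\mathbb{Q}(q)$-algebra with generators $e',f$ and relation $e'f=q^{-2}fe'+1$. Put $[n]=\frac{q^n-q^{-n}}{q-q^{-1}}$, $[k]!=[1]\cdots[k]$, $f^{(k)}=f^k/[k]!$, $C=\frac{qt+q^{-1}t^{-1}}{(q-q^{-1})^2}+fe$ and $c_n=\frac{q^{n+1}+q^{-n-1}}{(q-q^{-1})^2}$. For a $U_q$-module $M$ and $n\in\mathbb{Z}$ let $M_n=\{m\in M: tm=q^nm\}$ and $M_n^e=\{m\in M_n: em=0\}$, and let $M^{c}$ be the generalized $c$-eigenspace of $C$. *The category $\mathcal{I}$.* $M$ is in $\mathcal{I}$ if $M=\bigoplus_{n\in\mathbb{Z}}M_n$, the action of $U_q^-$ on $M$ is torsion free, and $e$ acts locally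 nilpotently. Such an $M$ is *complete* (in Enright's sense) if $f^{n+1}:M_n^e\to M_{-n-2}^e$ is bijective for all integers $n\ge 0$. *The modules $T(n)$.* For $n\ge0$ let $T(n)=U_q/U_q\{t-q^{-n-2},\,e^{n+2},\,(C-c_n)^2\}$. If $0\ne v\in T(n)_n^e$ and $z$ is a $U_q$-generator of $T(n)$ of weight $-n-2$, then $T(n)=U_q^-v\oplus U_q^-z$; the standard $\mathcal{B}_q$-structure on $T(n)$ is the one in which $f$ acts as in $U_q$ and $e'(f^px)=q^{-(p-1)}[p]f^{p-1}x$ for $x\in\{v,z\}$, $p\ge0$ (read as $0$ for $p=0$). *The category $\widetilde{\mathcal{I}}$.* $M$ is in $\widetilde{\mathcal{I}}$ if it is a finitely generated $U_q$-module in $\mathcal{I}$ equipped with a $\mathcal{B}_q$-module structure such that: (a) $f\in\mathcal{B}_q$ acts as $f\in U_q$; (b) if $m\in M\setminus fM$ is a weight vector with $em=0$, then $e'm=0$; (c) if $n\ge0$ and $m\in M^{c_n}\setminus fM$ has weight $-n-2$ and $em\neq0$, then there is a $U_q$- and $\mathcal{B}_q$-submodule $T\subseteq M$ that is isomorphic,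 simultaneously as a $U_q$- and as a $\mathcal{B}_q$-module, to $T(n)$ with a standard $\mathcal{B}_q$-structure, and $em=e\widetilde m$ for some $U_q$-generator $\widetilde m$ of $T$ of weight $-n-2$. *Crystal bases.* For $M$ in $\widetilde{\mathcal{I}}$ one has $M=\bigoplus_{k\ge0}f^{(k)}\operatorname{Ker}e'$, and the Kashiwara operators are the linear maps with $\widetilde f(f^{(k)}u)=f^{(k+1)}u$, $\widetilde e(f^{(k)}u)=f^{(k-1)}u$ for $k\ge1$, and $\widetilde e(u)=0$, for all $u\in\operatorname{Ker}e'$. Let $\mathbb{A}\subset\mathbb{Q}(q)$ be the ring of rational functions regular at $q=0$. A crystal lattice of $M$ is a free $\mathbb{A}$-submodule $L\subseteq M$ such that the canonical map $\mathbb{Q}(q)\otimes_{\mathbb{A}}L\to M$ is an isomorphism, $\widetilde eL\subseteq L$ and $\widetilde fL\subseteq L$. A crystal basis of $M$ is a pair $(L,B)$ of a crystal lattice $L$ and a $\mathbb{Q}$-basis $B$ of $L/qL$ such that $\widetilde eB\subseteq B\cup\{0\}$, $\widetilde fB\subseteq B$, and $b=\widetilde f\widetilde eb$ whenever $b\in B$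 and $\widetilde eb\in B$. Put $L_n^e=L\cap M_n^e$. The crystal basis $(L,B)$ is *complete* if $\widetilde f^{\,n+1}:L_n^e\to L_{-n-2}^e$ is bijective for all integers $n\ge0$. **Theorem.** Let $(L,B)$ be a crystal basis of a module $M$ in $\widetilde{\mathcal{I}}$. Then $(L,B)$ is complete if and only if $M$ is complete. -/

import Mathlib

noncomputable section

namespace CrystalSL2

open Polynomial

/-- The field `ℚ(q)` of rational functions in the indeterminate `q`. -/
abbrev K : Type := RatFunc ℚ

/-- The indeterminate `q`. -/
abbrev q : K := RatFunc.X

/-- The ring `𝔸` of rational functions that are regular at `q = 0`, as a `ℚ`-subalgebra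
of `ℚ(q)`: the quotients `p / r` of polynomials with `r(0) ≠ 0`. -/
def A : Subalgebra ℚ K where
  carrier := {x | ∃ p r : ℚ[X], r.eval 0 ≠ 0 ∧
    x = algebraMap ℚ[X] K p / algebraMap ℚ[X] K r}
  mul_mem' := by
    rintro _ _ ⟨p, r, hr, rfl⟩ ⟨p', r', hr', rfl⟩
    refine ⟨p * p', r * r', ?_, ?_⟩
    · rw [eval_mul]; exact mul_ne_zero hr hr'
    · rw [map_mul, map_mul, div_mul_div_comm]
  add_mem' := by
    rintro _ _ ⟨p, r, hr, rfl⟩ ⟨p', r', hr', rfl⟩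
    have h : ∀ s : ℚ[X], s.eval 0 ≠ 0 → algebraMap ℚ[X] K s ≠ 0 := by
      intro s hs h0
      have : s = 0 := (map_eq_zero_iff _ (IsFractionRing.injective ℚ[X] K)).1 h0
      exact hs (by rw [this, eval_zero])
    refine ⟨p * r' + r * p', r * r', ?_, ?_⟩
    · rw [eval_mul]; exact mul_ne_zero hr hr'
    · rw [div_add_div _ _ (h r hr) (h r' hr')]
      simp only [map_add, map_mul]
  algebraMap_mem' := by
    intro c
    refine ⟨C c, 1, by simp, ?_⟩
    rw [map_one, div_one, IsScalarTower.algebraMap_apply ℚ ℚ[X] K]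
    rfl

/-- The indeterminate `q`, as an element of `𝔸`. -/
def qA : A := ⟨q, X, 1, by simp, by simp [RatFunc.algebraMap_X]⟩

/-- The `q`-integer `[n] = (qⁿ - q⁻ⁿ) / (q - q⁻¹)`. -/
def qInt (n : ℤ) : K := (q ^ n - q ^ (-n)) / (q - q⁻¹)

/-- The `q`-factorial `[n]! = [1][2]⋯[n]`. -/
def qFactorial (n : ℕ) : K := ∏ i ∈ Finset.range n, qInt ((i : ℤ) + 1)

/-! ### The quantized enveloping algebra of `sl₂` -/

/-- The generators `e, f, t, t⁻¹` of `U_q(sl₂)`. -/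
inductive UqGen : Type
  | e | f | t | tinv

/-- The generators of `U_q(sl₂)` in the free algebra. -/
abbrev ug (g : UqGen) : FreeAlgebra K UqGen := FreeAlgebra.ι K g

/-- The defining relations of `U_q(sl₂)`. -/
inductive UqRel : FreeAlgebra K UqGen → FreeAlgebra K UqGen → Prop
  | t_tinv : UqRel (ug .t * ug .tinv) 1
  | tinv_t : UqRel (ug .tinv * ug .t) 1
  | t_e : UqRel (ug .t * ug .e * ug .tinv) (q ^ 2 • ug .e)
  | t_f : UqRel (ug .t * ug .f * ug .tinv) ((q ^ 2)⁻¹ • ug .f)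
  | e_f : UqRel (ug .e * ug .f - ug .f * ug .e) ((q - q⁻¹)⁻¹ • (ug .t - ug .tinv))

/-- The `ℚ(q)`-algebra `U_q = U_q(sl₂)`. -/
abbrev Uq : Type := RingQuot UqRel

namespace Uq

/-- The generator `e` of `U_q`. -/
def e : Uq := RingQuot.mkAlgHom K UqRel (ug .e)
/-- The generator `f` of `U_q`. -/
def f : Uq := RingQuot.mkAlgHom K UqRel (ug .f)
/-- The generator `t` of `U_q`. -/
def t : Uq := RingQuot.mkAlgHom K UqRel (ug .t)
/-- The generator `t⁻¹` of `U_q`. -/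
def tinv : Uq := RingQuot.mkAlgHom K UqRel (ug .tinv)

/-- The subalgebra `U_q⁻` of `U_q` generated by `f`. -/
def minus : Subalgebra K Uq := Algebra.adjoin K {f}

/-- The quantum Casimir element `(q t + q⁻¹ t⁻¹) / (q - q⁻¹)² + f e`. -/
def casimir : Uq := ((q - q⁻¹) ^ 2)⁻¹ • (q • t + q⁻¹ • tinv) + f * e

end Uq

/-- The scalar `c_n = (qⁿ⁺¹ + q⁻ⁿ⁻¹) / (q - q⁻¹)²`. -/
def casimirValue (n : ℤ) : K := (q ^ (n + 1) + q ^ (-n - 1)) / (q - q⁻¹) ^ 2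

/-! ### Kashiwara's algebra for `sl₂` -/

/-- The generators `e', f` of `𝓑_q`. -/
inductive BqGen : Type
  | e' | f

/-- The generators of `𝓑_q` in the free algebra. -/
abbrev bg (g : BqGen) : FreeAlgebra K BqGen := FreeAlgebra.ι K g

/-- The defining relation `e' f = q⁻² f e' + 1` of `𝓑_q`. -/
inductive BqRel : FreeAlgebra K BqGen → FreeAlgebra K BqGen → Prop
  | e'_f : BqRel (bg .e' * bg .f) ((q ^ 2)⁻¹ • (bg .f * bg .e') + 1)

/-- Kashiwara's `ℚ(q)`-algebra `𝓑_q = 𝓑_q(sl₂)`. -/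
abbrev Bq : Type := RingQuot BqRel

namespace Bq

/-- The generator `e'` of `𝓑_q`. -/
def e' : Bq := RingQuot.mkAlgHom K BqRel (bg .e')
/-- The generator `f` of `𝓑_q`. -/
def f : Bq := RingQuot.mkAlgHom K BqRel (bg .f)

/-- The divided power `f⁽ᵏ⁾ = fᵏ / [k]!`. -/
def fDiv (k : ℕ) : Bq := (qFactorial k)⁻¹ • f ^ k

end Bq

/-! ### `U_q`-modules: the category `𝓘` and completeness -/

section UqModules

variable (M : Type*) [AddCommGroup M] [Module K M] [Module Uq M] [IsScalarTower K Uq M]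

/-- The weight space `M_n = {m | t m = qⁿ m}`. -/
def weightSpace (n : ℤ) : Submodule K M :=
  Module.End.eigenspace (Algebra.lsmul K K M Uq.t) (q ^ n)

/-- `M_n^e = {m ∈ M_n | e m = 0}`. -/
def primitiveSpace (n : ℤ) : Submodule K M :=
  weightSpace M n ⊓ LinearMap.ker (Algebra.lsmul K K M Uq.e)

/-- The generalized eigenspace `M^c` of the Casimir element with eigenvalue `c`. -/
def casimirSpace (c : K) : Submodule K M :=
  Module.End.maxGenEigenspace (Algebra.lsmul K K M Uq.casimir) c

/-- `f · M`. -/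
def fRange : Submodule K M := LinearMap.range (Algebra.lsmul K K M Uq.f)

/-- `M` belongs to the category `𝓘`: it is a weight module, torsion free over `U_q⁻`, and
`e` acts locally nilpotently. -/
structure IsInI : Prop where
  weight : DirectSum.IsInternal (weightSpace M)
  torsion_free : ∀ u ∈ Uq.minus, u ≠ 0 → ∀ m : M, u • m = 0 → m = 0
  e_nilpotent : ∀ m : M, ∃ k : ℕ, Uq.e ^ k • m = 0

/-- `M` is complete (in Enright's sense): `fⁿ⁺¹ : M_n^e → M_{-n-2}^e` is bijective for
all `n ≥ 0`. -/
def IsCompleteModule : Prop :=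
  ∀ n : ℕ, Set.BijOn (fun m : M => Uq.f ^ (n + 1) • m)
    (primitiveSpace M (n : ℤ)) (primitiveSpace M (-(n : ℤ) - 2))

end UqModules

/-! ### The modules `T(n)` and their standard `𝓑_q`-structures -/

/-- The left ideal `I(n)` of `U_q` generated by `t - q⁻ⁿ⁻²`, `eⁿ⁺²` and `(C - c_n)²`. -/
def idealT (n : ℕ) : Submodule Uq Uq :=
  Submodule.span Uq {Uq.t - algebraMap K Uq (q ^ (-(n : ℤ) - 2)), Uq.e ^ (n + 2),
    (Uq.casimir - algebraMap K Uq (casimirValue n)) ^ 2}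

/-- The module `T(n) = U_q / I(n)`. -/
abbrev T (n : ℕ) : Type := Uq ⧸ idealT n

/-- `ε` is the operator `e'` of a standard `𝓑_q`-structure on `T(n)`. For a nonzero vector `v`
of weight `n` with `e v = 0` and a `U_q`-generator `z` of weight `-n-2` one has
`T(n) = U_q⁻ v ⊕ U_q⁻ z`, and `e'` acts by `e' (u v) = e'(u) v` and `e' (u z) = e'(u) z`, where
`e'` acts on `U_q⁻ = ℚ(q)[f]` by `e'(fᵖ) = q^{-(p-1)} [p] fᵖ⁻¹` (which is `0` for `p = 0`);
`f` acts as `f ∈ U_q` does. -/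
def IsStandardEPrime (n : ℕ) (ε : Module.End K (T n)) : Prop :=
  ∃ v z : T n, v ≠ 0 ∧ v ∈ primitiveSpace (T n) (n : ℤ) ∧
    z ∈ weightSpace (T n) (-(n : ℤ) - 2) ∧ Submodule.span Uq {z} = ⊤ ∧
    ∀ p : ℕ,
      ε (Uq.f ^ p • v) = (q ^ (-((p : ℤ) - 1)) * qInt p) • (Uq.f ^ (p - 1) • v) ∧
      ε (Uq.f ^ p • z) = (q ^ (-((p : ℤ) - 1)) * qInt p) • (Uq.f ^ (p - 1) • z)

/-! ### The category `𝓘~` -/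

section UqBqModules

variable (M : Type*) [AddCommGroup M] [Module K M] [Module Uq M] [IsScalarTower K Uq M]
  [Module Bq M] [IsScalarTower K Bq M]

/-- `M` is an object of `𝓘~`: a finitely generated `U_q`-module in `𝓘` with a compatible
`𝓑_q`-structure. -/
structure IsInITilde : Prop where
  fg : Module.Finite Uq M
  inI : IsInI M
  /-- `f ∈ 𝓑_q` acts as `f ∈ U_q`. -/
  f_smul : ∀ m : M, Bq.f • m = Uq.f • m
  e'_smul : ∀ n : ℤ, ∀ m ∈ weightSpace M n, m ∉ fRange M → Uq.e • m = 0 → Bq.e' • m = 0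
  /-- The submodule `S` below is `U_q`- and `𝓑_q`-stable, it is isomorphic, by one and the same
  map, to `T(n)` as a `U_q`-module and as a `𝓑_q`-module with standard `𝓑_q`-structure, and it
  has a generator `m'` of weight `-n-2` with `e m = e m'`. -/
  exists_T : ∀ n : ℕ, ∀ m ∈ casimirSpace M (casimirValue n),
    m ∈ weightSpace M (-(n : ℤ) - 2) → m ∉ fRange M → Uq.e • m ≠ 0 →
    ∃ S : Submodule Uq M,
      (∀ b : Bq, ∀ x ∈ S, b • x ∈ S) ∧
      (∃ ε : Module.End K (T n), IsStandardEPrime n ε ∧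
        ∃ φ : T n ≃ₗ[Uq] S, ∀ x : T n, (φ (ε x) : M) = Bq.e' • (φ x : M)) ∧
      ∃ m' ∈ weightSpace M (-(n : ℤ) - 2), Submodule.span Uq {m'} = S ∧ Uq.e • m = Uq.e • m'

end UqBqModules

/-! ### Kashiwara operators and crystal bases of `𝓑_q`-modules -/

section BqModules

variable (M : Type*) [AddCommGroup M] [Module K M] [Module Bq M] [IsScalarTower K Bq M]

/-- `Ker e'`. -/
def kerE' : Submodule K M := LinearMap.ker (Algebra.lsmul K K M Bq.e')

/-- The map `(u_k)_k ↦ ∑ₖ f⁽ᵏ⁾ u_k` from finitely supported sequences in `Ker e'` to `M`. -/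
def decompMap : (ℕ →₀ kerE' M) →ₗ[K] M :=
  Finsupp.lsum K fun k => Algebra.lsmul K K M (Bq.fDiv k) ∘ₗ (kerE' M).subtype

open Classical in
/-- The map `u = ∑ₖ f⁽ᵏ⁾ u_k ↦ (u_k)_k`, for modules with `M = ⊕ₖ f⁽ᵏ⁾ Ker e'` (such as the
modules in `𝓘~`, or more generally those on which `e'` is locally nilpotent); it has the
junk value `0` for other modules. -/
def components : M →ₗ[K] (ℕ →₀ kerE' M) :=
  if h : Function.Bijective (decompMap M) then
    ((LinearEquiv.ofBijective (decompMap M) h).symm : M →ₗ[K] (ℕ →₀ kerE' M))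
  else 0

/-- Kashiwara's operator `f~`, with `f~ (f⁽ᵏ⁾ u) = f⁽ᵏ⁺¹⁾ u` for `u ∈ Ker e'`. -/
def fTilde : Module.End K M :=
  decompMap M ∘ₗ Finsupp.lmapDomain (kerE' M) K Nat.succ ∘ₗ components M

/-- Kashiwara's operator `e~`, with `e~ (f⁽ᵏ⁾ u) = f⁽ᵏ⁻¹⁾ u` for `k ≥ 1` and `e~ u = 0`, for
`u ∈ Ker e'`. -/
def eTilde : Module.End K M :=
  decompMap M ∘ₗ Finsupp.lcomapDomain Nat.succ Nat.succ_injective ∘ₗ components M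

variable {M}

/-- A crystal lattice of `M`: a free `𝔸`-submodule `L` such that the canonical map
`ℚ(q) ⊗_𝔸 L → M` is an isomorphism, stable under `e~` and `f~`. -/
structure IsCrystalLattice (L : Submodule A M) : Prop where
  free : Module.Free A L
  baseChange : IsBaseChange K L.subtype
  eTilde_mem : ∀ x ∈ L, eTilde M x ∈ L
  fTilde_mem : ∀ x ∈ L, fTilde M x ∈ L

/-- The quotient `L / qL`. -/
abbrev ModQ (L : Submodule A M) : Type _ := L ⧸ Ideal.span {qA} • (⊤ : Submodule A L)

/-- `L / qL` as a `ℚ`-vector space, through `ℚ → 𝔸`. -/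
instance instModuleModQ (L : Submodule A M) : Module ℚ (ModQ L) :=
  Module.compHom (ModQ L) (algebraMap ℚ A)

/-- The map induced on `L / qL` by an operator on `M` that preserves `L`. -/
def reduction (L : Submodule A M) (φ : Module.End K M) (h : ∀ x ∈ L, φ x ∈ L) :
    ModQ L →ₗ[A] ModQ L :=
  Submodule.mapQ _ _ ((φ.restrictScalars A).restrict h) (Submodule.smul_top_le_comap_smul_top _ _)

/-- A crystal basis `(L, B)` of the `𝓑_q`-module `M`: a crystal lattice `L` and a `ℚ`-basis `B`
of `L / qL` with the stated behaviour under the maps induced by `e~` and `f~`. -/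
structure CrystalBasis (M : Type*) [AddCommGroup M] [Module K M] [Module Bq M]
    [IsScalarTower K Bq M] where
  L : Submodule A M
  B : Set (ModQ L)
  lattice : IsCrystalLattice L
  linearIndependent : LinearIndependent ℚ ((↑) : B → ModQ L)
  span_eq_top : Submodule.span ℚ B = ⊤
  eTilde_mem : ∀ b ∈ B, reduction L (eTilde M) lattice.eTilde_mem b ∈ B ∪ {0}
  fTilde_mem : ∀ b ∈ B, reduction L (fTilde M) lattice.fTilde_mem b ∈ B
  fTilde_eTilde : ∀ b ∈ B, reduction L (eTilde M) lattice.eTilde_mem b ∈ B →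
    b = reduction L (fTilde M) lattice.fTilde_mem (reduction L (eTilde M) lattice.eTilde_mem b)

end BqModules

/-! ### Completeness of crystal lattices and crystal bases -/

section Completeness

variable {M : Type*} [AddCommGroup M] [Module K M] [Module Uq M] [IsScalarTower K Uq M]
  [Module Bq M] [IsScalarTower K Bq M]

/-- `L_n^e = L ∩ M_n^e`. -/
def latticePrimitive (L : Submodule A M) (n : ℤ) : Set M := L ∩ primitiveSpace M n

/-- The crystal lattice `L` is complete: `f~ⁿ⁺¹ : L_n^e → L_{-n-2}^e` is bijective for
all `n ≥ 0`. -/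
def IsCompleteLattice (L : Submodule A M) : Prop :=
  ∀ n : ℕ, Set.BijOn ((fTilde M ^ (n + 1) : Module.End K M))
    (latticePrimitive L (n : ℤ)) (latticePrimitive L (-(n : ℤ) - 2))

/-- A crystal basis `(L, B)` is complete if the crystal lattice `L` is complete. -/
def CrystalBasis.IsComplete (LB : CrystalBasis M) : Prop := IsCompleteLattice LB.L

end Completeness

end CrystalSL2

end

/-!
Both completeness conditions compare vectors of `M_n^e` with vectors of `M_{-n-2}^e`, and on
`M_n^e`, `n ≥ 0`, Kashiwara's operator `f~ⁿ⁺¹` is a scalar multiple of `fⁿ⁺¹`. Once this is known,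
the theorem follows from two properties of a crystal lattice `L`. Every vector of `M` has a
nonzero multiple in `L`, so completeness of `L` gives that of `M`. Conversely, if `y ∈ L` is
primitive of weight `-n-2` and `y = f⁽ⁿ⁺¹⁾ w` with `w ∈ M_n^e`, then `w = e~ⁿ⁺¹ y` lies in `L`,
because `e~` preserves `L`.

For `f~ⁿ⁺¹ = f⁽ⁿ⁺¹⁾` on `M_n^e` two facts are needed. The first is `e' M_n^e = 0`
(`e'_smul_eq_zero_of_primitive`): a generalized Casimir eigenspace for `c_n`, `n ≥ -1`, has no
weights above `n` (`eq_zero_of_lt`), so that `M_n^e ∩ f M = 0`, and the condition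
`IsInITilde.e'_smul` applies.

The second is the decomposition `M = ⊕ₖ f⁽ᵏ⁾ Ker e'` (`decompMap_bijective`). The relation `e'
f⁽ᵏ⁺¹⁾ u = q⁻ᵏ f⁽ᵏ⁾ u` for `u ∈ Ker e'` reduces it to the local nilpotency of `e'`
(`nilSpace_eq_top`). The vectors killed by a power of `e'` form a subspace stable under `f`, and
`M` is the sum of the blocks `M_k ∩ M^{c_n}` (`weightSpace_le_iSup_block`), on which one argues by
descending induction on `k` (`block_le_nilSpace`). A vector of a block outside `f M` has `c_k =
c_n`, since `C - c_k = f e` is invertible on the block otherwise. If it is primitive, then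
`IsInITilde.e'_smul` applies. If not, then `k = -n-2`, and by `IsInITilde.exists_T` it differs by
a primitive vector from an element of a copy of `T(n)`; there `e'` is locally nilpotent because
the copy is spanned by the vectors `fᵖ z` and `fᵖ w`, with `z` the standard generator and `w`
primitive of weight `n` (`mem_nilSpace_of_standard`).
-/

namespace CrystalSL2

/-! ### Scalars -/

lemma q_ne_zero : q ≠ 0 := RatFunc.X_ne_zero

/-- `q` is not a root of unity. -/
lemma q_zpow_injective : Function.Injective fun n : ℤ => q ^ n := by
  have key : ∀ n : ℕ, q ^ n = 1 → n = 0 := by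
    intro n h
    have h' : algebraMap (Polynomial ℚ) K (Polynomial.X ^ n) = algebraMap (Polynomial ℚ) K 1 := by
      rw [map_pow, RatFunc.algebraMap_X, map_one]; exact h
    have h2 := IsFractionRing.injective (Polynomial ℚ) K h'
    simpa using congrArg Polynomial.natDegree h2
  intro a b h
  have h1 : q ^ (a - b) = 1 := by
    rw [zpow_sub₀ q_ne_zero]
    exact (div_eq_one_iff_eq (zpow_ne_zero _ q_ne_zero)).2 h
  rcases Int.eq_nat_or_neg (a - b) with ⟨m, hm | hm⟩
  · rw [hm, zpow_natCast] at h1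
    have := key m h1
    omega
  · rw [hm, zpow_neg, zpow_natCast, inv_eq_one] at h1
    have := key m h1
    omega

lemma q_zpow_ne {a b : ℤ} (h : a ≠ b) : q ^ a ≠ q ^ b := fun h' => h (q_zpow_injective h')

lemma q_sub_inv_ne_zero : q - q⁻¹ ≠ 0 := by
  have h := q_zpow_ne (show (1 : ℤ) ≠ -1 by norm_num)
  rw [zpow_one, zpow_neg_one] at h
  exact sub_ne_zero.2 h

lemma q_sq_sub_one_ne_zero : q ^ 2 - 1 ≠ 0 := by
  have h : q ^ 2 - 1 = q * (q - q⁻¹) := by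
    have := q_ne_zero
    field_simp
  rw [h]
  exact mul_ne_zero q_ne_zero q_sub_inv_ne_zero

lemma qFactorial_ne_zero (n : ℕ) : qFactorial n ≠ 0 :=
  Finset.prod_ne_zero_iff.2 fun i _ =>
    div_ne_zero (sub_ne_zero.2 (q_zpow_ne (by omega))) q_sub_inv_ne_zero

lemma qFactorial_succ (n : ℕ) : qFactorial (n + 1) = qInt ((n : ℤ) + 1) * qFactorial n := by
  rw [qFactorial, Finset.prod_range_succ, mul_comm]; rfl

lemma casimirValue_neg_sub_two (n : ℤ) : casimirValue (-n - 2) = casimirValue n := by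
  unfold casimirValue
  rw [show -n - 2 + 1 = -n - 1 by ring, show -(-n - 2) - 1 = n + 1 by ring, add_comm]

lemma casimirValue_eq_iff {a b : ℤ} : casimirValue a = casimirValue b ↔ a = b ∨ a = -b - 2 := by
  refine ⟨fun h => ?_, ?_⟩
  · unfold casimirValue at h
    rw [div_left_inj' (pow_ne_zero 2 q_sub_inv_ne_zero)] at h
    -- with `x = q ^ (a + 1)` and `y = q ^ (b + 1)`, `x + x⁻¹ = y + y⁻¹` factors as
    -- `(x - y) (x y - 1) = 0`
    have hx := zpow_ne_zero (a + 1) q_ne_zero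
    have hy := zpow_ne_zero (b + 1) q_ne_zero
    rw [show -a - 1 = -(a + 1) by ring, show -b - 1 = -(b + 1) by ring, zpow_neg, zpow_neg] at h
    have h2 : (q ^ (a + 1) - q ^ (b + 1)) * (q ^ (a + 1) * q ^ (b + 1) - 1) = 0 := by
      field_simp at h
      linear_combination h
    rcases mul_eq_zero.1 h2 with h3 | h3
    · left
      have := q_zpow_injective (sub_eq_zero.1 h3)
      omega
    · right
      rw [← zpow_add₀ q_ne_zero, ← zpow_zero q] at h3
      have := q_zpow_injective (sub_eq_zero.1 h3)
      omega
  · rintro (rfl | rfl)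
    · rfl
    · exact casimirValue_neg_sub_two b

/-! ### Relations in `U_q` -/

namespace Uq

lemma t_mul_tinv : t * tinv = 1 := by
  simpa [t, tinv] using RingQuot.mkAlgHom_rel K UqRel.t_tinv

lemma tinv_mul_t : tinv * t = 1 := by
  simpa [t, tinv] using RingQuot.mkAlgHom_rel K UqRel.tinv_t

lemma t_mul_e : t * e = q ^ 2 • (e * t) := by
  have h : t * e * tinv = q ^ 2 • e := by
    simpa [t, e, tinv] using RingQuot.mkAlgHom_rel K UqRel.t_e
  rw [← smul_mul_assoc, ← h, mul_assoc, tinv_mul_t, mul_one]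

lemma t_mul_f : t * f = (q ^ 2)⁻¹ • (f * t) := by
  have h : t * f * tinv = (q ^ 2)⁻¹ • f := by
    simpa [t, f, tinv] using RingQuot.mkAlgHom_rel K UqRel.t_f
  rw [← smul_mul_assoc, ← h, mul_assoc, tinv_mul_t, mul_one]

lemma e_mul_f : e * f = f * e + (q - q⁻¹)⁻¹ • (t - tinv) := by
  have h : e * f - f * e = (q - q⁻¹)⁻¹ • (t - tinv) := by
    simpa [t, e, f, tinv] using RingQuot.mkAlgHom_rel K UqRel.e_f
  rw [← h]; abel

lemma tinv_mul_e : tinv * e = (q ^ 2)⁻¹ • (e * tinv) := by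
  have h : tinv * (t * e) * tinv = q ^ 2 • (tinv * e) := by
    rw [t_mul_e, mul_smul_comm, smul_mul_assoc, mul_assoc, mul_assoc, t_mul_tinv, mul_one]
  rw [← mul_assoc, tinv_mul_t, one_mul] at h
  rw [h, smul_smul, inv_mul_cancel₀ (pow_ne_zero 2 q_ne_zero), one_smul]

lemma tinv_mul_f : tinv * f = q ^ 2 • (f * tinv) := by
  have h : tinv * (t * f) * tinv = (q ^ 2)⁻¹ • (tinv * f) := by
    rw [t_mul_f, mul_smul_comm, smul_mul_assoc, mul_assoc, mul_assoc, t_mul_tinv, mul_one]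
  rw [← mul_assoc, tinv_mul_t, one_mul] at h
  rw [h, smul_smul, mul_inv_cancel₀ (pow_ne_zero 2 q_ne_zero), one_smul]

lemma casimir_commute_f : Commute casimir f := by
  have h1 := q_sq_sub_one_ne_zero
  have h2 := q_ne_zero
  have hef : f * e * f = f * (f * e) + (q - q⁻¹)⁻¹ • (f * t - f * tinv) := by
    rw [mul_assoc, e_mul_f, mul_add, mul_smul_comm, mul_sub]
  have key {F V : Type} [Field F] [AddCommGroup V] [Module F V] {q : F} (h1 : q ^ 2 - 1 ≠ 0)
      (h2 : q ≠ 0) (x y z : V) :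
      ((q - q⁻¹) ^ 2)⁻¹ • (q • (q ^ 2)⁻¹ • x + q⁻¹ • q ^ 2 • y) + (z + (q - q⁻¹)⁻¹ • (x - y)) =
        ((q - q⁻¹) ^ 2)⁻¹ • (q • x + q⁻¹ • y) + z := by
    match_scalars <;> field_simp <;> ring
  unfold Commute SemiconjBy casimir
  rw [add_mul, mul_add, hef]
  simp only [smul_mul_assoc, mul_smul_comm, add_mul, mul_add, t_mul_f, tinv_mul_f]
  exact key h1 h2 _ _ _

lemma casimir_commute_e : Commute casimir e := by
  have h1 := q_sq_sub_one_ne_zero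
  have h2 := q_ne_zero
  have hef : e * (f * e) =
      f * e * e + (q - q⁻¹)⁻¹ • (q ^ 2 • (e * t) - (q ^ 2)⁻¹ • (e * tinv)) := by
    rw [← mul_assoc, e_mul_f, add_mul, smul_mul_assoc, sub_mul, t_mul_e, tinv_mul_e]
  have key {F V : Type} [Field F] [AddCommGroup V] [Module F V] {q : F} (h1 : q ^ 2 - 1 ≠ 0)
      (h2 : q ≠ 0) (x y z : V) :
      ((q - q⁻¹) ^ 2)⁻¹ • (q • q ^ 2 • x + q⁻¹ • (q ^ 2)⁻¹ • y) + z =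
        ((q - q⁻¹) ^ 2)⁻¹ • (q • x + q⁻¹ • y) +
          (z + (q - q⁻¹)⁻¹ • (q ^ 2 • x - (q ^ 2)⁻¹ • y)) := by
    match_scalars <;> field_simp <;> ring
  unfold Commute SemiconjBy casimir
  rw [add_mul, mul_add, hef]
  simp only [smul_mul_assoc, mul_smul_comm, add_mul, mul_add, t_mul_e, tinv_mul_e]
  exact key h1 h2 _ _ _

lemma casimir_commute_t : Commute casimir t := by
  have h : f * e * t = t * (f * e) := by
    rw [← mul_assoc, t_mul_f, smul_mul_assoc, mul_assoc f t e, t_mul_e, mul_smul_comm, smul_smul,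
      inv_mul_cancel₀ (pow_ne_zero 2 q_ne_zero), one_smul, mul_assoc]
  unfold Commute SemiconjBy casimir
  rw [add_mul, mul_add, h]
  simp only [smul_mul_assoc, mul_smul_comm, add_mul, mul_add, t_mul_tinv, tinv_mul_t]

lemma casimir_commute_tinv : Commute casimir tinv := by
  unfold Commute SemiconjBy
  calc casimir * tinv = tinv * t * (casimir * tinv) := by rw [tinv_mul_t, one_mul]
    _ = tinv * (t * casimir) * tinv := by simp only [mul_assoc]
    _ = tinv * (casimir * t) * tinv := by rw [casimir_commute_t.eq]
    _ = tinv * casimir * (t * tinv) := by simp only [mul_assoc]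
    _ = tinv * casimir := by rw [t_mul_tinv, mul_one]

lemma eq_top_of_generators_mem (S : Subalgebra K Uq) (he : e ∈ S) (hf : f ∈ S) (ht : t ∈ S)
    (htinv : tinv ∈ S) : S = ⊤ := by
  rw [eq_top_iff]
  rintro x -
  obtain ⟨y, rfl⟩ := RingQuot.mkAlgHom_surjective K UqRel x
  induction y using FreeAlgebra.induction with
  | grade0 r => rw [AlgHom.commutes]; exact S.algebraMap_mem r
  | grade1 g => cases g <;> assumption
  | mul a b ha hb => rw [map_mul]; exact S.mul_mem ha hb
  | add a b ha hb => rw [map_add]; exact S.add_mem ha hb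

lemma casimir_commute (u : Uq) : Commute casimir u := by
  have h := eq_top_of_generators_mem (Subalgebra.centralizer K {casimir})
    (by simpa [Subalgebra.mem_centralizer_iff] using casimir_commute_e.eq)
    (by simpa [Subalgebra.mem_centralizer_iff] using casimir_commute_f.eq)
    (by simpa [Subalgebra.mem_centralizer_iff] using casimir_commute_t.eq)
    (by simpa [Subalgebra.mem_centralizer_iff] using casimir_commute_tinv.eq)
  have hu : u ∈ Subalgebra.centralizer K {casimir} := h ▸ Algebra.mem_top
  exact Subalgebra.mem_centralizer_iff K |>.1 hu _ rfl

/-- The action of the generators of `U_q` on functions `ℤ → ℚ(q)` in which `f` is the shift and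
the Casimir element acts as zero. -/
noncomputable def shiftGen : UqGen → Module.End K (ℤ → K)
  | .e => LinearMap.pi fun k =>
      (-(q ^ (2 * k - 1) + q ^ (1 - 2 * k)) / (q - q⁻¹) ^ 2) • LinearMap.proj (k - 1)
  | .f => LinearMap.pi fun k => LinearMap.proj (k + 1)
  | .t => LinearMap.pi fun k => q ^ (2 * k) • LinearMap.proj k
  | .tinv => LinearMap.pi fun k => q ^ (-(2 * k)) • LinearMap.proj k

lemma shiftGen_rel ⦃x y : FreeAlgebra K UqGen⦄ (h : UqRel x y) :
    FreeAlgebra.lift K shiftGen x = FreeAlgebra.lift K shiftGen y := by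
  have h0 := q_ne_zero
  have h1 := q_sq_sub_one_ne_zero
  have h2 : q ^ 2 ≠ 0 := pow_ne_zero 2 h0
  cases h <;> ext g k <;> have h3 := zpow_ne_zero k h2 <;>
    simp [shiftGen, zpow_sub₀ h0, zpow_sub₀ h2, zpow_add₀ h2, mul_sub, zpow_mul] <;>
    generalize (q ^ 2) ^ k = y at * <;> field_simp
  ring

/-- This makes `f` act injectively on the modules of `𝓘`, where only nonzero elements of `U_q⁻` are
assumed to act without torsion. -/
lemma f_ne_zero : f ≠ 0 := by
  intro h
  have h1 : RingQuot.liftAlgHom K ⟨FreeAlgebra.lift K shiftGen, shiftGen_rel⟩ f = shiftGen .f := by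
    simp [f]
  rw [h, map_zero] at h1
  have h2 := congrFun (LinearMap.congr_fun h1 fun _ => 1) 0
  simp [shiftGen] at h2

end Uq

/-! ### Weights and Casimir eigenvalues -/

section UqModule

variable {M : Type*} [AddCommGroup M] [Module K M] [Module Uq M] [IsScalarTower K Uq M]

lemma mem_weightSpace {k : ℤ} {x : M} : x ∈ weightSpace M k ↔ Uq.t • x = q ^ k • x := by
  rw [weightSpace, Module.End.mem_eigenspace_iff]; rfl

lemma tinv_smul {k : ℤ} {x : M} (hx : x ∈ weightSpace M k) : Uq.tinv • x = q ^ (-k) • x := by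
  rw [mem_weightSpace] at hx
  have h : x = q ^ k • Uq.tinv • x := by
    rw [← smul_comm, ← hx, smul_smul, Uq.tinv_mul_t, one_smul]
  rw [zpow_neg, eq_inv_smul_iff₀ (zpow_ne_zero k q_ne_zero), ← h]

lemma mem_primitiveSpace {k : ℤ} {x : M} :
    x ∈ primitiveSpace M k ↔ x ∈ weightSpace M k ∧ Uq.e • x = 0 := Iff.rfl

lemma e_smul_mem {k : ℤ} {x : M} (hx : x ∈ weightSpace M k) :
    Uq.e • x ∈ weightSpace M (k + 2) := by
  rw [mem_weightSpace] at hx ⊢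
  rw [smul_smul, Uq.t_mul_e, smul_assoc, mul_smul, hx, smul_comm Uq.e, smul_smul, add_comm,
    zpow_add₀ q_ne_zero]
  rfl

lemma f_smul_mem {k : ℤ} {x : M} (hx : x ∈ weightSpace M (k + 2)) :
    Uq.f • x ∈ weightSpace M k := by
  rw [mem_weightSpace] at hx ⊢
  rw [smul_smul, Uq.t_mul_f, smul_assoc, mul_smul, hx, smul_comm Uq.f, smul_smul, add_comm,
    zpow_add₀ q_ne_zero, ← mul_assoc, zpow_ofNat, inv_mul_cancel₀ (pow_ne_zero 2 q_ne_zero),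
    one_mul]

lemma f_pow_smul_mem {k : ℤ} {x : M} (p : ℕ) (hx : x ∈ weightSpace M (k + 2 * p)) :
    Uq.f ^ p • x ∈ weightSpace M k := by
  induction p generalizing k with
  | zero => simpa using hx
  | succ p ih =>
    rw [pow_succ', mul_smul]
    refine f_smul_mem (ih ?_)
    rwa [show k + 2 + 2 * (p : ℤ) = k + 2 * ((p + 1 : ℕ) : ℤ) by push_cast; ring]

/-- On a vector of weight `k`, the Casimir element acts as `c_k + f e`. -/
lemma casimir_smul {k : ℤ} {x : M} (hx : x ∈ weightSpace M k) :
    Uq.casimir • x = casimirValue k • x + Uq.f • Uq.e • x := by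
  have h1 := tinv_smul hx
  rw [mem_weightSpace] at hx
  rw [Uq.casimir, add_smul, smul_assoc, add_smul, smul_assoc, smul_assoc, hx, h1, mul_smul,
    smul_smul, smul_smul, ← add_smul, smul_smul]
  congr 2
  rw [casimirValue, div_eq_inv_mul, add_comm k 1, zpow_add₀ q_ne_zero, zpow_one,
    sub_eq_add_neg (-k) 1, add_comm (-k), zpow_add₀ q_ne_zero, zpow_neg_one]

lemma mem_casimirSpace {c : K} {x : M} :
    x ∈ casimirSpace M c ↔ ∃ N : ℕ, (Uq.casimir - algebraMap K Uq c) ^ N • x = 0 := by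
  have h : Algebra.lsmul K K M Uq.casimir - c • (1 : Module.End K M) =
      Algebra.lsmul K K M (Uq.casimir - algebraMap K Uq c) := by
    rw [map_sub, AlgHom.commutes, Algebra.algebraMap_eq_smul_one]
  simp only [casimirSpace, Module.End.mem_maxGenEigenspace, h, ← map_pow]
  rfl

lemma casimir_sub_commute (c : K) (u : Uq) : Commute (Uq.casimir - algebraMap K Uq c) u :=
  (Uq.casimir_commute u).sub_left (Algebra.commute_algebraMap_left c u)

lemma smul_mem_casimirSpace {c : K} {x : M} (u : Uq) (hx : x ∈ casimirSpace M c) :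
    u • x ∈ casimirSpace M c := by
  rw [mem_casimirSpace] at hx ⊢
  obtain ⟨N, hN⟩ := hx
  refine ⟨N, ?_⟩
  rw [smul_smul, ((casimir_sub_commute c u).pow_left N).eq, mul_smul, hN, smul_zero]

lemma mem_casimirSpace_of_primitive {k : ℤ} {x : M} (hx : x ∈ weightSpace M k)
    (he : Uq.e • x = 0) : x ∈ casimirSpace M (casimirValue k) := by
  refine mem_casimirSpace.2 ⟨1, ?_⟩
  rw [pow_one, sub_smul, casimir_smul hx, he, smul_zero, add_zero, algebraMap_smul, sub_self]

/-- For `c ≠ c_k` the operator `C - c_k = f e` is invertible on the generalized `c`-eigenspace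
in weight `k`. -/
lemma exists_f_e_smul_eq {k : ℤ} {c : K} (hc : casimirValue k ≠ c) {x : M}
    (hx : x ∈ weightSpace M k) (hxc : x ∈ casimirSpace M c) :
    ∃ y ∈ weightSpace M k, y ∈ casimirSpace M c ∧ Uq.f • Uq.e • y = x := by
  obtain ⟨N, hN⟩ := mem_casimirSpace.1 hxc
  induction N generalizing x with
  | zero =>
    rw [pow_zero, one_smul] at hN
    exact ⟨0, zero_mem _, zero_mem _, by rw [hN, smul_zero, smul_zero]⟩
  | succ N ih =>
    have hd : c - casimirValue k ≠ 0 := sub_ne_zero.2 hc.symm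
    have hfe : Uq.f • Uq.e • x ∈ weightSpace M k := f_smul_mem (e_smul_mem hx)
    have hD : (Uq.casimir - algebraMap K Uq c) • x
        = Uq.f • Uq.e • x - (c - casimirValue k) • x := by
      rw [sub_smul, casimir_smul hx, algebraMap_smul, sub_smul]; abel
    obtain ⟨y, hy, hyc, h⟩ := ih (x := (Uq.casimir - algebraMap K Uq c) • x)
      (hD ▸ sub_mem hfe (Submodule.smul_mem _ _ hx)) (smul_mem_casimirSpace _ hxc)
      (by rw [smul_smul, ← pow_succ, hN])
    refine ⟨(c - casimirValue k)⁻¹ • (x - y), Submodule.smul_mem _ _ (sub_mem hx hy),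
      Submodule.smul_mem _ _ (sub_mem hxc hyc), ?_⟩
    rw [smul_comm Uq.e, smul_comm Uq.f, inv_smul_eq_iff₀ hd, smul_sub, smul_sub, h, hD]
    abel

lemma f_smul_injective (hM : IsInI M) {x : M} (hx : Uq.f • x = 0) : x = 0 :=
  hM.torsion_free Uq.f (Algebra.subset_adjoin rfl) Uq.f_ne_zero x hx

lemma f_pow_smul_injective (hM : IsInI M) (p : ℕ) {x : M} (hx : Uq.f ^ p • x = 0) : x = 0 := by
  induction p with
  | zero => simpa using hx
  | succ p ih =>
    rw [pow_succ', mul_smul] at hx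
    exact ih (f_smul_injective hM hx)

lemma mem_weightSpace_of_f_smul (hM : IsInI M) {k : ℤ} {x : M}
    (hx : Uq.f • x ∈ weightSpace M k) : x ∈ weightSpace M (k + 2) := by
  rw [mem_weightSpace] at hx ⊢
  rw [smul_smul, Uq.t_mul_f, smul_assoc, inv_smul_eq_iff₀ (pow_ne_zero 2 q_ne_zero), smul_smul,
    mul_smul] at hx
  rw [← sub_eq_zero]
  apply f_smul_injective hM
  rw [smul_sub, hx, smul_comm Uq.f, add_comm, zpow_add₀ q_ne_zero, sub_eq_zero]
  rfl

lemma mem_casimirSpace_of_f_smul (hM : IsInI M) {c : K} {x : M}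
    (hx : Uq.f • x ∈ casimirSpace M c) : x ∈ casimirSpace M c := by
  rw [mem_casimirSpace] at hx ⊢
  obtain ⟨N, hN⟩ := hx
  refine ⟨N, f_smul_injective hM ?_⟩
  rw [smul_smul, ← ((casimir_sub_commute c Uq.f).pow_left N).eq, mul_smul, hN]

/-- The generalized `c_n`-eigenspace of the Casimir element has no weights above `n`, for
`n ≥ -1`: a nonzero vector there could be raised by powers of `e` to a primitive vector, whose
Casimir eigenvalue would not be `c_n`. -/
lemma eq_zero_of_lt (hM : IsInI M) {n k : ℤ} (hn : -1 ≤ n) (hk : n < k) {x : M}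
    (hx : x ∈ weightSpace M k) (hxc : x ∈ casimirSpace M (casimirValue n)) : x = 0 := by
  obtain ⟨j, hj⟩ := hM.e_nilpotent x
  induction j generalizing x k with
  | zero => simpa using hj
  | succ j ih =>
    have he : Uq.e • x = 0 := ih (k := k + 2) (by omega) (e_smul_mem hx)
      (smul_mem_casimirSpace _ hxc) (by rw [smul_smul, ← pow_succ, hj])
    have hne : casimirValue k ≠ casimirValue n := by
      rw [Ne, casimirValue_eq_iff]; omega
    exact Submodule.disjoint_def.1 (Module.End.disjoint_genEigenspace _ hne ⊤ ⊤) x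
      (mem_casimirSpace_of_primitive hx he) hxc

end UqModule

/-! ### Blocks: weight spaces of generalized Casimir eigenspaces -/

section UqModule

variable {M : Type*} [AddCommGroup M] [Module K M] [Module Uq M] [IsScalarTower K Uq M]

/-- The part of weight `k` of the generalized `c_n`-eigenspace of the Casimir element. -/
noncomputable def block (M : Type*) [AddCommGroup M] [Module K M] [Module Uq M]
    [IsScalarTower K Uq M] (n k : ℤ) : Submodule K M :=
  weightSpace M k ⊓ casimirSpace M (casimirValue n)

lemma e_smul_mem_block {n k : ℤ} {x : M} (hx : x ∈ block M n k) :
    Uq.e • x ∈ block M n (k + 2) :=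
  ⟨e_smul_mem hx.1, smul_mem_casimirSpace _ hx.2⟩

lemma f_smul_mem_block {n k : ℤ} {x : M} (hx : x ∈ block M n (k + 2)) :
    Uq.f • x ∈ block M n k :=
  ⟨f_smul_mem hx.1, smul_mem_casimirSpace _ hx.2⟩

lemma mem_block_of_f_smul (hM : IsInI M) {n k : ℤ} {x : M} (hx : Uq.f • x ∈ block M n k) :
    x ∈ block M n (k + 2) :=
  ⟨mem_weightSpace_of_f_smul hM hx.1, mem_casimirSpace_of_f_smul hM hx.2⟩

lemma primitiveSpace_le_block (k : ℤ) : primitiveSpace M k ≤ block M k k :=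
  fun _ hx => ⟨hx.1, mem_casimirSpace_of_primitive hx.1 hx.2⟩

lemma e_smul_eq_zero_of_mem_block (hM : IsInI M) {n : ℤ} (hn : -1 ≤ n) {x : M}
    (hx : x ∈ block M n n) : Uq.e • x = 0 :=
  have h := e_smul_mem_block hx
  eq_zero_of_lt hM hn (by omega) h.1 h.2

lemma eq_zero_of_primitive_of_mem_fRange (hM : IsInI M) {n : ℤ} (hn : -1 ≤ n) {x : M}
    (hx : x ∈ primitiveSpace M n) (hf : x ∈ fRange M) : x = 0 := by
  obtain ⟨y, rfl⟩ := hf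
  have h := mem_block_of_f_smul hM (primitiveSpace_le_block n hx)
  rw [eq_zero_of_lt hM hn (by omega) h.1 h.2, map_zero]

/-- `f ^ (n + 1)` maps primitive vectors of weight `n` to primitive vectors, because the
Casimir element acts on both weights `n` and `-n - 2` of a primitive vector by `c_n`. -/
lemma f_pow_smul_mem_primitiveSpace (hM : IsInI M) (n : ℕ) {x : M}
    (hx : x ∈ primitiveSpace M (n : ℤ)) :
    Uq.f ^ (n + 1) • x ∈ primitiveSpace M (-(n : ℤ) - 2) := by
  have hw : Uq.f ^ (n + 1) • x ∈ weightSpace M (-(n : ℤ) - 2) := by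
    apply f_pow_smul_mem
    rw [show -(n : ℤ) - 2 + 2 * ((n + 1 : ℕ) : ℤ) = n by push_cast; ring]
    exact hx.1
  refine mem_primitiveSpace.2 ⟨hw, f_smul_injective hM ?_⟩
  have h1 := casimir_smul hw
  have h2 : Uq.casimir • x = casimirValue n • x := by
    rw [casimir_smul hx.1, show Uq.e • x = 0 from hx.2, smul_zero, add_zero]
  rw [smul_smul, (Uq.casimir_commute _).eq, mul_smul, h2, smul_comm, casimirValue_neg_sub_two] at h1
  exact left_eq_add.1 h1

/-- Below weight `n` and down to weight `-n`, the generalized `c_n`-eigenspace is generated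
by its primitive vectors of weight `n`. -/
lemma exists_f_pow_smul_eq (hM : IsInI M) {n j : ℕ} (hj : j ≤ n) {x : M}
    (hx : x ∈ block M n ((n : ℤ) - 2 * j)) :
    ∃ w ∈ primitiveSpace M (n : ℤ), Uq.f ^ j • w = x := by
  induction j generalizing x with
  | zero =>
    have hx' : x ∈ block M n n := by simpa using hx
    exact ⟨x, ⟨hx'.1, e_smul_eq_zero_of_mem_block hM (by omega) hx'⟩, by rw [pow_zero, one_smul]⟩
  | succ j ih =>
    have hne : casimirValue ((n : ℤ) - 2 * (j + 1 : ℕ)) ≠ casimirValue n := by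
      rw [Ne, casimirValue_eq_iff]; push_cast; omega
    obtain ⟨y, hy, hyc, h⟩ := exists_f_e_smul_eq hne hx.1 hx.2
    have hey := e_smul_mem_block (n := n) ⟨hy, hyc⟩
    rw [show (n : ℤ) - 2 * (j + 1 : ℕ) + 2 = n - 2 * j by push_cast; ring] at hey
    obtain ⟨w, hw, hwy⟩ := ih (by omega) hey
    exact ⟨w, hw, by rw [pow_succ', mul_smul, hwy, h]⟩

/-- A vector of weight `k` that `C - c_k = f e` sends into the sum of the blocks lies in that sum,
because `f e` is onto each block with eigenvalue other than `c_k`. -/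
lemma mem_iSup_block_of_f_e_smul {k : ℤ} {x : M} (hx : x ∈ weightSpace M k)
    (h : Uq.f • Uq.e • x ∈ ⨆ n : ℕ, block M ((n : ℤ) - 1) k) :
    x ∈ ⨆ n : ℕ, block M ((n : ℤ) - 1) k := by
  -- modulo vectors of the summand with `c_n = c_k`, the vector `f e x` can be lifted along `f e`
  have key : ∀ y ∈ ⨆ n : ℕ, block M ((n : ℤ) - 1) k,
      ∃ z ∈ ⨆ n : ℕ, block M ((n : ℤ) - 1) k, z ∈ weightSpace M k ∧
        Uq.f • Uq.e • z - y ∈ casimirSpace M (casimirValue k) := by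
    intro y hy
    induction hy using Submodule.iSup_induction' with
    | mem n y hy =>
      by_cases hc : casimirValue k = casimirValue ((n : ℤ) - 1)
      · refine ⟨0, zero_mem _, zero_mem _, ?_⟩
        rw [smul_zero, smul_zero, zero_sub, hc]
        exact neg_mem hy.2
      · obtain ⟨z, hz, hzc, h⟩ := exists_f_e_smul_eq hc hy.1 hy.2
        exact ⟨z, Submodule.mem_iSup_of_mem n ⟨hz, hzc⟩, hz, by rw [h, sub_self]; exact zero_mem _⟩
    | zero => exact ⟨0, zero_mem _, zero_mem _, by simp⟩
    | add y y' _ _ ih ih' =>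
      obtain ⟨z, hz, hzk, h⟩ := ih
      obtain ⟨z', hz', hzk', h'⟩ := ih'
      refine ⟨z + z', add_mem hz hz', add_mem hzk hzk', ?_⟩
      rw [smul_add, smul_add, add_sub_add_comm]
      exact add_mem h h'
  obtain ⟨z, hz, hzk, hd⟩ := key _ h
  have hxz : x - z ∈ casimirSpace M (casimirValue k) := by
    have hD : (Uq.casimir - algebraMap K Uq (casimirValue k)) • (x - z) =
        -(Uq.f • Uq.e • z - Uq.f • Uq.e • x) := by
      rw [sub_smul, casimir_smul (sub_mem hx hzk), algebraMap_smul, smul_sub Uq.e, smul_sub Uq.f]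
      abel
    obtain ⟨N, hN⟩ := mem_casimirSpace.1 (neg_mem hd)
    exact mem_casimirSpace.2 ⟨N + 1, by rw [pow_succ, mul_smul, hD, hN]⟩
  -- the summand with eigenvalue `c_k` has label `|k + 1|`, since `c_k = c_{-k-2}`
  obtain ⟨m, hm⟩ : ∃ m : ℕ, casimirValue ((m : ℤ) - 1) = casimirValue k :=
    ⟨(k + 1).natAbs, casimirValue_eq_iff.2 (by omega)⟩
  rw [← sub_add_cancel x z]
  exact add_mem (Submodule.mem_iSup_of_mem m ⟨sub_mem hx hzk, hm ▸ hxz⟩) hz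

lemma weightSpace_le_iSup_block (hM : IsInI M) (k : ℤ) :
    weightSpace M k ≤ ⨆ n : ℕ, block M ((n : ℤ) - 1) k := by
  intro x hx
  obtain ⟨j, hj⟩ := hM.e_nilpotent x
  induction j generalizing x k with
  | zero =>
    rw [pow_zero, one_smul] at hj
    rw [hj]; exact zero_mem _
  | succ j ih =>
    apply mem_iSup_block_of_f_e_smul hx
    have h := ih (k + 2) (e_smul_mem hx) (by rw [smul_smul, ← pow_succ, hj])
    have hle : ⨆ n : ℕ, block M ((n : ℤ) - 1) (k + 2) ≤
        (⨆ n : ℕ, block M ((n : ℤ) - 1) k).comap (Algebra.lsmul K K M Uq.f) :=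
      iSup_le fun n y hy => Submodule.mem_iSup_of_mem n (f_smul_mem_block hy)
    exact hle h

/-- A `ℚ(q)`-subspace stable under the generators of `U_q` contains the
`U_q`-submodules generated by its elements. -/
lemma span_subset_of_stable (W : Submodule K M) (he : ∀ x ∈ W, Uq.e • x ∈ W)
    (hf : ∀ x ∈ W, Uq.f • x ∈ W) (ht : ∀ x ∈ W, Uq.t • x ∈ W)
    (htinv : ∀ x ∈ W, Uq.tinv • x ∈ W) {z : M} (hz : z ∈ W) {x : M}
    (hx : x ∈ Submodule.span Uq {z}) : x ∈ W := by
  obtain ⟨u, rfl⟩ := Submodule.mem_span_singleton.1 hx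
  let S : Subalgebra K Uq :=
    { carrier := {u | ∀ x ∈ W, u • x ∈ W}
      mul_mem' := fun {a b} ha hb x hx => by rw [mul_smul]; exact ha _ (hb _ hx)
      add_mem' := fun {a b} ha hb x hx => by rw [add_smul]; exact add_mem (ha _ hx) (hb _ hx)
      algebraMap_mem' := fun r x hx => by rw [algebraMap_smul]; exact W.smul_mem _ hx }
  have hu : u ∈ S := Uq.eq_top_of_generators_mem S he hf ht htinv ▸ Algebra.mem_top
  exact hu _ hz

/-- If `e z = f ^ n w` with `w` primitive, then `U_q z` is spanned by the vectors `f ^ p z` and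
`f ^ p w`. -/
lemma span_subset_of_e_smul_eq {k l : ℤ} {z w : M} {n : ℕ} (hz : z ∈ weightSpace M k)
    (hw : w ∈ primitiveSpace M l) (hzw : Uq.e • z = Uq.f ^ n • w) {x : M}
    (hx : x ∈ Submodule.span Uq {z}) :
    x ∈ Submodule.span K (Set.range (fun p : ℕ => Uq.f ^ p • z) ∪
      Set.range fun p : ℕ => Uq.f ^ p • w) := by
  set W := Submodule.span K (Set.range (fun p : ℕ => Uq.f ^ p • z) ∪
      Set.range fun p : ℕ => Uq.f ^ p • w) with hW
  have hpz (p : ℕ) : Uq.f ^ p • z ∈ W := Submodule.subset_span (Or.inl ⟨p, rfl⟩)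
  have hpw (p : ℕ) : Uq.f ^ p • w ∈ W := Submodule.subset_span (Or.inr ⟨p, rfl⟩)
  have stable (u : Uq) (h1 : ∀ p : ℕ, u • Uq.f ^ p • z ∈ W) (h2 : ∀ p : ℕ, u • Uq.f ^ p • w ∈ W) :
      ∀ y ∈ W, u • y ∈ W := by
    intro y hy
    have hle : W ≤ W.comap (Algebra.lsmul K K M u) := by
      rw [hW, Submodule.span_le]
      rintro _ (⟨p, rfl⟩ | ⟨p, rfl⟩)
      exacts [h1 p, h2 p]
    exact hle hy
  have hf : ∀ y ∈ W, Uq.f • y ∈ W := by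
    refine stable _ (fun p => ?_) fun p => ?_
    · rw [smul_smul, ← pow_succ']; exact hpz _
    · rw [smul_smul, ← pow_succ']; exact hpw _
  have wt {i : ℤ} {y : M} (hy : y ∈ weightSpace M i) (p : ℕ) :
      Uq.f ^ p • y ∈ weightSpace M (i - 2 * p) :=
    f_pow_smul_mem p (by rwa [sub_add_cancel])
  have ht : ∀ y ∈ W, Uq.t • y ∈ W := by
    refine stable _ (fun p => ?_) fun p => ?_
    · rw [mem_weightSpace.1 (wt hz p)]; exact W.smul_mem _ (hpz p)
    · rw [mem_weightSpace.1 (wt hw.1 p)]; exact W.smul_mem _ (hpw p)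
  have htinv : ∀ y ∈ W, Uq.tinv • y ∈ W := by
    refine stable _ (fun p => ?_) fun p => ?_
    · rw [tinv_smul (wt hz p)]; exact W.smul_mem _ (hpz p)
    · rw [tinv_smul (wt hw.1 p)]; exact W.smul_mem _ (hpw p)
  have he_pow (y : M) (hy : ∀ p : ℕ, Uq.f ^ p • y ∈ W) (hey : Uq.e • y ∈ W) (p : ℕ) :
      Uq.e • Uq.f ^ p • y ∈ W := by
    induction p with
    | zero => rwa [pow_zero, one_smul]
    | succ p ih =>
      rw [pow_succ', mul_smul, smul_smul, Uq.e_mul_f, add_smul, mul_smul, smul_assoc, sub_smul]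
      exact add_mem (hf _ ih) (W.smul_mem _ (sub_mem (ht _ (hy p)) (htinv _ (hy p))))
  refine span_subset_of_stable W (stable _ (he_pow z hpz ?_) (he_pow w hpw ?_)) hf ht htinv
    (by simpa using hpz 0) hx
  · rw [hzw]; exact hpw n
  · rw [show Uq.e • w = 0 from hw.2]; exact zero_mem _

/-- `(C - c_n) ^ 2` annihilates `T(n)`, because the Casimir element is central. -/
lemma mem_casimirSpace_T (n : ℕ) (x : T n) : x ∈ casimirSpace (T n) (casimirValue n) := by
  obtain ⟨u, rfl⟩ := Submodule.Quotient.mk_surjective _ x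
  refine mem_casimirSpace.2 ⟨2, ?_⟩
  rw [← Submodule.Quotient.mk_smul, Submodule.Quotient.mk_eq_zero, smul_eq_mul,
    ((casimir_sub_commute _ u).pow_left 2).eq]
  exact Submodule.smul_mem _ u (Submodule.subset_span (by simp))

end UqModule

/-! ### Kashiwara's decomposition -/

section BqModule

variable {M : Type*} [AddCommGroup M] [Module K M] [Module Bq M] [IsScalarTower K Bq M]

lemma e'_smul_f_smul (x : M) :
    Bq.e' • Bq.f • x = (q ^ 2)⁻¹ • Bq.f • Bq.e' • x + x := by
  have h : Bq.e' * Bq.f = (q ^ 2)⁻¹ • (Bq.f * Bq.e') + 1 := by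
    simpa [Bq.e', Bq.f] using RingQuot.mkAlgHom_rel K BqRel.e'_f
  rw [smul_smul, h, add_smul, one_smul, smul_assoc, mul_smul]

/-- The subspace of the vectors that are killed by a power of `e'`. -/
noncomputable def nilSpace (M : Type*) [AddCommGroup M] [Module K M] [Module Bq M]
    [IsScalarTower K Bq M] : Submodule K M :=
  Module.End.maxGenEigenspace (Algebra.lsmul K K M Bq.e') 0

lemma mem_nilSpace {x : M} : x ∈ nilSpace M ↔ ∃ N : ℕ, Bq.e' ^ N • x = 0 := by
  simp only [nilSpace, Module.End.mem_maxGenEigenspace, zero_smul, sub_zero, ← map_pow]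
  rfl

lemma mem_nilSpace_of_e'_smul {x : M} (hx : Bq.e' • x ∈ nilSpace M) : x ∈ nilSpace M := by
  obtain ⟨N, hN⟩ := mem_nilSpace.1 hx
  exact mem_nilSpace.2 ⟨N + 1, by rw [pow_succ, mul_smul, hN]⟩

lemma mem_nilSpace_of_e'_smul_eq_zero {x : M} (hx : Bq.e' • x = 0) : x ∈ nilSpace M :=
  mem_nilSpace_of_e'_smul (hx ▸ zero_mem _)

lemma f_smul_mem_nilSpace {x : M} (hx : x ∈ nilSpace M) : Bq.f • x ∈ nilSpace M := by
  obtain ⟨N, hN⟩ := mem_nilSpace.1 hx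
  induction N generalizing x with
  | zero =>
    rw [pow_zero, one_smul] at hN
    rw [hN, smul_zero]; exact zero_mem _
  | succ N ih =>
    rw [pow_succ, mul_smul] at hN
    apply mem_nilSpace_of_e'_smul
    rw [e'_smul_f_smul]
    exact add_mem (Submodule.smul_mem _ _ (ih (mem_nilSpace.2 ⟨N, hN⟩) hN)) hx

lemma fDiv_zero : Bq.fDiv 0 = 1 := by simp [Bq.fDiv, qFactorial]

lemma f_pow_eq_smul_fDiv (k : ℕ) : Bq.f ^ k = qFactorial k • Bq.fDiv k := by
  rw [Bq.fDiv, smul_inv_smul₀ (qFactorial_ne_zero k)]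

lemma e'_smul_f_pow_smul (k : ℕ) {u : M} (hu : Bq.e' • u = 0) :
    Bq.e' • Bq.f ^ (k + 1) • u = (q ^ (-(k : ℤ)) * qInt ((k : ℤ) + 1)) • Bq.f ^ k • u := by
  induction k with
  | zero =>
    have h := q_sub_inv_ne_zero
    rw [zero_add, pow_one, e'_smul_f_smul, hu, smul_zero, smul_zero, zero_add, pow_zero, one_smul]
    simp [qInt, div_self h]
  | succ k ih =>
    have h1 := q_sq_sub_one_ne_zero
    have h2 := q_ne_zero
    have h3 := zpow_ne_zero (k : ℤ) h2
    have hsmul (a : K) (y : M) : a • y + y = (a + 1) • y := by rw [add_smul, one_smul]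
    rw [pow_succ', mul_smul, e'_smul_f_smul, ih, smul_comm Bq.f, smul_smul Bq.f, ← pow_succ',
      smul_smul, hsmul]
    congr 1
    simp only [qInt, zpow_neg, Nat.cast_add, Nat.cast_one, zpow_add₀ h2, zpow_one]
    generalize q ^ (k : ℤ) = y at *
    field_simp
    ring

lemma e'_smul_fDiv_smul (k : ℕ) {u : M} (hu : Bq.e' • u = 0) :
    Bq.e' • Bq.fDiv (k + 1) • u = q ^ (-(k : ℤ)) • Bq.fDiv k • u := by
  have h0 := qFactorial_ne_zero k
  have h1 := qFactorial_ne_zero (k + 1)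
  have h2 : qInt ((k : ℤ) + 1) ≠ 0 := by
    rw [qFactorial_succ] at h1; exact left_ne_zero_of_mul h1
  rw [Bq.fDiv, smul_assoc, smul_comm, e'_smul_f_pow_smul k hu, f_pow_eq_smul_fDiv, smul_assoc,
    smul_smul, smul_smul, qFactorial_succ]
  congr 1
  field_simp

lemma decompMap_single (k : ℕ) (u : kerE' M) :
    decompMap M (Finsupp.single k u) = Bq.fDiv k • (u : M) := by
  simp [decompMap]

/-- `e'` acts on `∑ₖ f⁽ᵏ⁾ u_k` by `(u_k)_k ↦ (q⁻ᵏ u_{k+1})_k`. -/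
lemma e'_smul_decompMap (v : ℕ →₀ kerE' M) :
    ∃ w : ℕ →₀ kerE' M, (∀ k : ℕ, w k = q ^ (-(k : ℤ)) • v (k + 1)) ∧
      Bq.e' • decompMap M v = decompMap M w := by
  induction v using Finsupp.induction_linear with
  | zero => exact ⟨0, by simp, by simp⟩
  | add v v' ih ih' =>
    obtain ⟨w, hw, h⟩ := ih
    obtain ⟨w', hw', h'⟩ := ih'
    exact ⟨w + w', fun k => by simp [hw, hw'], by rw [map_add, map_add, smul_add, h, h']⟩
  | single k u =>
    have hu : Bq.e' • (u : M) = 0 := u.2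
    rw [decompMap_single]
    cases k with
    | zero =>
      refine ⟨0, fun k => ?_, ?_⟩
      · rw [Finsupp.single_eq_of_ne (by omega)]; simp
      · rw [fDiv_zero, one_smul, hu, map_zero]
    | succ k =>
      refine ⟨Finsupp.single k (q ^ (-(k : ℤ)) • u), fun j => ?_, ?_⟩
      · by_cases hj : j = k
        · subst hj; simp
        · rw [Finsupp.single_eq_of_ne hj, Finsupp.single_eq_of_ne (by omega), smul_zero]
      · rw [decompMap_single, e'_smul_fDiv_smul k hu, Submodule.coe_smul, smul_comm]

lemma decompMap_injective : Function.Injective (decompMap M) := by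
  rw [← LinearMap.ker_eq_bot, LinearMap.ker_eq_bot']
  intro v hv
  obtain ⟨N, hN⟩ : ∃ N : ℕ, ∀ k, N ≤ k → v k = 0 := by
    refine ⟨v.support.sup id + 1, fun k hk => ?_⟩
    by_contra h
    have := Finset.le_sup (f := id) (Finsupp.mem_support_iff.2 h)
    simp only [id_eq] at this
    omega
  induction N generalizing v with
  | zero => ext1 k; exact hN k (Nat.zero_le k)
  | succ N ih =>
    obtain ⟨w, hw, h⟩ := e'_smul_decompMap v
    rw [hv, smul_zero] at h
    have hw0 := ih w h.symm fun k hk => by rw [hw, hN _ (by omega), smul_zero]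
    have hv1 (k : ℕ) : v (k + 1) = 0 := by
      have := hw k
      rw [hw0, Finsupp.coe_zero, Pi.zero_apply, eq_comm,
        smul_eq_zero_iff_right (zpow_ne_zero _ q_ne_zero)] at this
      exact this
    have hv0 : v = Finsupp.single 0 (v 0) := by
      ext1 k
      cases k with
      | zero => simp
      | succ k => rw [hv1, Finsupp.single_eq_of_ne (by omega)]
    rw [hv0, decompMap_single, fDiv_zero, one_smul, Submodule.coe_eq_zero] at hv
    rw [hv0, hv, Finsupp.single_zero]

/-- Every vector killed by a power of `e'` lies in `∑ₖ f⁽ᵏ⁾ Ker e'`: an element of this sum with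
the same image under `e'` is subtracted to reach `Ker e'`. -/
lemma nilSpace_le_range_decompMap : nilSpace M ≤ LinearMap.range (decompMap M) := by
  -- `e'` maps the sum onto itself
  have lift (w : ℕ →₀ kerE' M) : ∃ v, Bq.e' • decompMap M v = decompMap M w := by
    induction w using Finsupp.induction_linear with
    | zero => exact ⟨0, by simp⟩
    | add w w' ih ih' =>
      obtain ⟨v, h⟩ := ih
      obtain ⟨v', h'⟩ := ih'
      exact ⟨v + v', by rw [map_add, map_add, smul_add, h, h']⟩
    | single k u =>
      refine ⟨Finsupp.single (k + 1) (q ^ (k : ℤ) • u), ?_⟩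
      have hu : Bq.e' • (u : M) = 0 := u.2
      rw [decompMap_single, decompMap_single, Submodule.coe_smul,
        smul_comm (Bq.fDiv (k + 1)) (q ^ (k : ℤ)), smul_comm Bq.e' (q ^ (k : ℤ)),
        e'_smul_fDiv_smul k hu, smul_smul, ← zpow_add₀ q_ne_zero, add_neg_cancel, zpow_zero,
        one_smul]
  intro x hx
  obtain ⟨N, hN⟩ := mem_nilSpace.1 hx
  induction N generalizing x with
  | zero =>
    rw [pow_zero, one_smul] at hN
    rw [hN]; exact zero_mem _
  | succ N ih =>
    rw [pow_succ, mul_smul] at hN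
    obtain ⟨w, hw⟩ := ih (mem_nilSpace.2 ⟨N, hN⟩) hN
    obtain ⟨v, hv⟩ := lift w
    have h0 : Bq.e' • (x - decompMap M v) = 0 := by rw [smul_sub, hv, hw, sub_self]
    refine ⟨v + Finsupp.single 0 ⟨x - decompMap M v, h0⟩, ?_⟩
    rw [map_add, decompMap_single, fDiv_zero, one_smul, add_sub_cancel]

lemma components_decompMap (h : Function.Bijective (decompMap M)) (v : ℕ →₀ kerE' M) :
    components M (decompMap M v) = v := by
  rw [components, dif_pos h]
  exact (LinearEquiv.ofBijective (decompMap M) h).symm_apply_apply v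

lemma fTilde_fDiv_smul (h : Function.Bijective (decompMap M)) (k : ℕ) (u : kerE' M) :
    fTilde M (Bq.fDiv k • (u : M)) = Bq.fDiv (k + 1) • (u : M) := by
  rw [← decompMap_single, fTilde, LinearMap.comp_apply, LinearMap.comp_apply,
    components_decompMap h, Finsupp.lmapDomain_apply, Finsupp.mapDomain_single, decompMap_single]

lemma eTilde_fDiv_smul (h : Function.Bijective (decompMap M)) (k : ℕ) (u : kerE' M) :
    eTilde M (Bq.fDiv (k + 1) • (u : M)) = Bq.fDiv k • (u : M) := by
  rw [← decompMap_single, eTilde, LinearMap.comp_apply, LinearMap.comp_apply,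
    components_decompMap h, ← decompMap_single]
  congr 1
  exact Finsupp.comapDomain_single (f := Nat.succ) k u _

lemma fTilde_pow_apply (h : Function.Bijective (decompMap M)) (k : ℕ) {u : M}
    (hu : Bq.e' • u = 0) : (fTilde M ^ k) u = Bq.fDiv k • u := by
  induction k with
  | zero => rw [fDiv_zero, one_smul, pow_zero, Module.End.one_apply]
  | succ k ih =>
    rw [pow_succ', Module.End.mul_apply, ih]
    exact fTilde_fDiv_smul h k ⟨u, hu⟩

lemma eTilde_pow_apply_fDiv (h : Function.Bijective (decompMap M)) (k : ℕ) {u : M}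
    (hu : Bq.e' • u = 0) : (eTilde M ^ k) (Bq.fDiv k • u) = u := by
  induction k with
  | zero => rw [fDiv_zero, one_smul, pow_zero, Module.End.one_apply]
  | succ k ih =>
    have h1 : eTilde M (Bq.fDiv (k + 1) • u) = Bq.fDiv k • u := eTilde_fDiv_smul h k ⟨u, hu⟩
    rw [pow_succ, Module.End.mul_apply, h1, ih]

end BqModule

/-! ### Local nilpotency of `e'` -/

section UqBqModule

variable {M : Type*} [AddCommGroup M] [Module K M] [Module Uq M] [IsScalarTower K Uq M]
  [Module Bq M]

lemma Bq_f_pow_smul (hM : IsInITilde M) (p : ℕ) (x : M) : Bq.f ^ p • x = Uq.f ^ p • x := by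
  induction p with
  | zero => simp
  | succ p ih => rw [pow_succ', mul_smul, ih, hM.f_smul, pow_succ', mul_smul]

/-- Primitive vectors of weight `n ≥ -1` are killed by `e'`, because they are not in `f M`. -/
lemma e'_smul_eq_zero_of_primitive (hM : IsInITilde M) {n : ℤ} (hn : -1 ≤ n) {x : M}
    (hx : x ∈ primitiveSpace M n) : Bq.e' • x = 0 := by
  by_cases hf : x ∈ fRange M
  · rw [eq_zero_of_primitive_of_mem_fRange hM.inI hn hx hf, smul_zero]
  · exact hM.e'_smul n x hx.1 hf hx.2

variable [IsScalarTower K Bq M]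

lemma Uq_f_smul_mem_nilSpace (hM : IsInITilde M) {x : M} (hx : x ∈ nilSpace M) :
    Uq.f • x ∈ nilSpace M :=
  hM.f_smul x ▸ f_smul_mem_nilSpace hx

lemma f_pow_smul_mem_nilSpace (hM : IsInITilde M) {x : M} (hx : x ∈ nilSpace M) (p : ℕ) :
    Uq.f ^ p • x ∈ nilSpace M := by
  induction p with
  | zero => rwa [pow_zero, one_smul]
  | succ p ih => rw [pow_succ', mul_smul]; exact Uq_f_smul_mem_nilSpace hM ih

/-- `e'` is locally nilpotent on a copy of `T(n)` with a standard `𝓑_q`-structure: if `z` is its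
standard generator, then `e z = f ^ n w` for a primitive vector `w` of weight `n`, and the
submodule is spanned by the vectors `f ^ p z` and `f ^ p w`. -/
lemma mem_nilSpace_of_standard (hM : IsInITilde M) {n : ℕ} {S : Submodule Uq M}
    {ε : Module.End K (T n)} (hε : IsStandardEPrime n ε) (φ : T n ≃ₗ[Uq] S)
    (hφ : ∀ x : T n, (φ (ε x) : M) = Bq.e' • (φ x : M)) {x : M} (hx : x ∈ S) :
    x ∈ nilSpace M := by
  obtain ⟨v, z, -, -, hz, hspan, hε⟩ := hε
  let ψ : T n →ₗ[Uq] M := S.subtype ∘ₗ (φ : T n →ₗ[Uq] S)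
  have hψK (a : K) (y : T n) : ψ (a • y) = a • ψ y := by
    rw [← algebraMap_smul Uq a y, map_smul, algebraMap_smul]
  have hzw : ψ z ∈ weightSpace M (-(n : ℤ) - 2) := by
    rw [mem_weightSpace] at hz ⊢
    rw [← map_smul, hz, hψK]
  have hzc : ψ z ∈ casimirSpace M (casimirValue n) := by
    obtain ⟨N, hN⟩ := mem_casimirSpace.1 (mem_casimirSpace_T n z)
    exact mem_casimirSpace.2 ⟨N, by rw [← map_smul, hN, map_zero]⟩
  have hz0 : Bq.e' • ψ z = 0 := by
    have h := (hε 0).2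
    rw [Nat.cast_zero, show qInt 0 = 0 by simp [qInt], mul_zero, pow_zero, one_smul] at h
    have h' : ψ (ε z) = Bq.e' • ψ z := hφ z
    rw [← h', h, hψK, zero_smul]
  have hxz : x ∈ Submodule.span Uq {ψ z} := by
    have hmap : (Submodule.span Uq {z}).map ψ = S := by
      rw [hspan, Submodule.map_top, LinearMap.range_comp, LinearEquiv.range, Submodule.map_top,
        Submodule.range_subtype]
    rw [Submodule.map_span, Set.image_singleton] at hmap
    rwa [hmap]
  have hez := e_smul_mem_block (n := n) ⟨hzw, hzc⟩
  rw [show -(n : ℤ) - 2 + 2 = n - 2 * n by ring] at hez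
  obtain ⟨w, hw, hzw'⟩ := exists_f_pow_smul_eq hM.inI le_rfl hez
  have hw0 := e'_smul_eq_zero_of_primitive hM (by omega) hw
  refine Submodule.span_le.2 ?_ (span_subset_of_e_smul_eq hzw hw hzw'.symm hxz)
  rintro _ (⟨p, rfl⟩ | ⟨p, rfl⟩)
  · exact f_pow_smul_mem_nilSpace hM (mem_nilSpace_of_e'_smul_eq_zero hz0) p
  · exact f_pow_smul_mem_nilSpace hM (mem_nilSpace_of_e'_smul_eq_zero hw0) p

/-- `e'` is locally nilpotent on each block, by descending induction on the weight `k`. A block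
vector outside `f M` has `k = n` or `k = -n - 2`; if it is not primitive, then it differs by a
primitive vector from an element of a copy of `T(n)`. -/
lemma block_le_nilSpace (hM : IsInITilde M) {n : ℤ} (hn : -1 ≤ n) (k : ℤ) :
    block M n k ≤ nilSpace M := by
  obtain ⟨d, hd⟩ : ∃ d : ℕ, n < k + d := ⟨(n - k).toNat + 1, by omega⟩
  induction d generalizing k with
  | zero =>
    intro x hx
    rw [eq_zero_of_lt hM.inI hn (by simpa using hd) hx.1 hx.2]
    exact zero_mem _
  | succ d ih =>
    have hfM : ∀ x ∈ block M n k, x ∈ fRange M → x ∈ nilSpace M := by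
      rintro _ hx ⟨y, rfl⟩
      exact Uq_f_smul_mem_nilSpace hM
        (ih (k + 2) (by push_cast at hd; omega) (mem_block_of_f_smul hM.inI hx))
    have hprim : ∀ x ∈ block M n k, Uq.e • x = 0 → x ∈ nilSpace M := by
      intro x hx he
      by_cases hf : x ∈ fRange M
      · exact hfM x hx hf
      · exact mem_nilSpace_of_e'_smul_eq_zero (hM.e'_smul k x hx.1 hf he)
    intro x hx
    by_cases hf : x ∈ fRange M
    · exact hfM x hx hf
    by_cases he : Uq.e • x = 0
    · exact hprim x hx he
    have hc : casimirValue k = casimirValue n := by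
      by_contra hc
      obtain ⟨y, -, -, hy⟩ := exists_f_e_smul_eq hc hx.1 hx.2
      exact hf ⟨Uq.e • y, hy⟩
    have hkn : k ≠ n := by
      rintro rfl
      exact he (e_smul_eq_zero_of_mem_block hM.inI hn hx)
    obtain rfl : k = -n - 2 := (casimirValue_eq_iff.1 hc).resolve_left hkn
    lift n to ℕ using by omega
    obtain ⟨S, -, ⟨ε, hε, φ, hφ⟩, m, hm, hmS, hem⟩ := hM.exists_T n x hx.2 hx.1 hf he
    have hmN : m ∈ nilSpace M :=
      mem_nilSpace_of_standard hM hε φ hφ (hmS ▸ Submodule.mem_span_singleton_self m)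
    have hxm : x - m ∈ primitiveSpace M (-(n : ℤ) - 2) :=
      mem_primitiveSpace.2 ⟨sub_mem hx.1 hm, by rw [smul_sub, hem, sub_self]⟩
    have hxm' := primitiveSpace_le_block _ hxm
    rw [block, casimirValue_neg_sub_two] at hxm'
    rw [← sub_add_cancel x m]
    exact add_mem (hprim _ hxm' hxm.2) hmN

lemma nilSpace_eq_top (hM : IsInITilde M) : nilSpace M = ⊤ := by
  rw [eq_top_iff, ← hM.inI.weight.submodule_iSup_eq_top]
  exact iSup_le fun k => (weightSpace_le_iSup_block hM.inI k).trans
    (iSup_le fun n => block_le_nilSpace hM (by omega) k)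

lemma decompMap_bijective (hM : IsInITilde M) : Function.Bijective (decompMap M) :=
  ⟨decompMap_injective, fun _ =>
    nilSpace_le_range_decompMap (nilSpace_eq_top hM ▸ Submodule.mem_top)⟩

/-- On a primitive vector of weight `n ≥ 0` the operator `f~ᵏ` is the divided power `f⁽ᵏ⁾`. -/
lemma fTilde_pow_apply_primitive (hM : IsInITilde M) (n k : ℕ) {x : M}
    (hx : x ∈ primitiveSpace M (n : ℤ)) :
    (fTilde M ^ k) x = (qFactorial k)⁻¹ • Uq.f ^ k • x := by
  rw [fTilde_pow_apply (decompMap_bijective hM) k (e'_smul_eq_zero_of_primitive hM (by omega) hx),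
    Bq.fDiv, smul_assoc, Bq_f_pow_smul hM]

lemma eTilde_pow_f_pow_smul (hM : IsInITilde M) (n k : ℕ) {x : M}
    (hx : x ∈ primitiveSpace M (n : ℤ)) :
    (eTilde M ^ k) (Uq.f ^ k • x) = qFactorial k • x := by
  have h0 := e'_smul_eq_zero_of_primitive hM (by omega) hx
  rw [← Bq_f_pow_smul hM, f_pow_eq_smul_fDiv, smul_assoc, map_smul,
    eTilde_pow_apply_fDiv (decompMap_bijective hM) k h0]

end UqBqModule

/-! ### Lattices and completeness -/

lemma exists_mem_A_mul_mem_A (x : K) : ∃ a : A, (a : K) ≠ 0 ∧ (a : K) * x ∈ A := by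
  have hpoly (p : Polynomial ℚ) : algebraMap (Polynomial ℚ) K p ∈ A := ⟨p, 1, by simp, by simp⟩
  have h : algebraMap (Polynomial ℚ) K x.denom ≠ 0 :=
    (map_ne_zero_iff _ (IsFractionRing.injective (Polynomial ℚ) K)).2 x.denom_ne_zero
  refine ⟨⟨_, hpoly x.denom⟩, h, ?_⟩
  have hx : algebraMap (Polynomial ℚ) K x.denom * x = algebraMap (Polynomial ℚ) K x.num := by
    rw [mul_comm, ← eq_div_iff h, RatFunc.num_div_denom]
  exact hx ▸ hpoly x.num

/-- A crystal lattice contains a nonzero multiple of each vector. -/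
lemma exists_smul_mem_lattice {M : Type*} [AddCommGroup M] [Module K M] [Module Bq M]
    [IsScalarTower K Bq M] {L : Submodule A M} (hL : IsBaseChange K L.subtype) (x : M) :
    ∃ a : A, (a : K) ≠ 0 ∧ (a : K) • x ∈ L := by
  induction x using hL.inductionOn with
  | zero => exact ⟨1, one_ne_zero, by simp⟩
  | tmul x => exact ⟨1, one_ne_zero, by simp⟩
  | smul s x ih =>
    obtain ⟨a, ha, hx⟩ := ih
    obtain ⟨b, hb, hs⟩ := exists_mem_A_mul_mem_A s
    refine ⟨a * b, mul_ne_zero ha hb, ?_⟩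
    have h := L.smul_mem ⟨_, hs⟩ hx
    rw [Subalgebra.smul_def] at h
    convert h using 1
    rw [smul_smul, smul_smul]
    congr 1
    rw [Subalgebra.coe_mul]; ring
  | add x y ihx ihy =>
    obtain ⟨a, ha, hx⟩ := ihx
    obtain ⟨b, hb, hy⟩ := ihy
    refine ⟨a * b, mul_ne_zero ha hb, ?_⟩
    rw [Subalgebra.coe_mul, smul_add]
    refine add_mem ?_ ?_
    · rw [mul_comm, mul_smul]; exact L.smul_mem b hx
    · rw [mul_smul]; exact L.smul_mem a hy

lemma pow_apply_mem {M : Type*} [AddCommGroup M] [Module K M] {L : Submodule A M}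
    {φ : Module.End K M} (h : ∀ x ∈ L, φ x ∈ L) (k : ℕ) {x : M} (hx : x ∈ L) :
    (φ ^ k) x ∈ L := by
  induction k with
  | zero => exact hx
  | succ k ih => rw [pow_succ', Module.End.mul_apply]; exact h _ ih

end CrystalSL2

open CrystalSL2

theorem mainTheorem2 {M : Type*} [AddCommGroup M] [Module CrystalSL2.K M]
    [Module CrystalSL2.Uq M] [IsScalarTower CrystalSL2.K CrystalSL2.Uq M]
    [Module CrystalSL2.Bq M] [IsScalarTower CrystalSL2.K CrystalSL2.Bq M]
    (hM : CrystalSL2.IsInITilde M) (LB : CrystalSL2.CrystalBasis M) :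
    LB.IsComplete ↔ CrystalSL2.IsCompleteModule M := by
  constructor
  · intro h n
    refine ⟨fun x hx => f_pow_smul_mem_primitiveSpace hM.inI n hx, fun x _ y _ hxy => ?_,
      fun y hy => ?_⟩
    · refine sub_eq_zero.1 (f_pow_smul_injective hM.inI (n + 1) ?_)
      rw [smul_sub, sub_eq_zero]
      exact hxy
    · obtain ⟨a, ha, hay⟩ := exists_smul_mem_lattice LB.lattice.baseChange y
      obtain ⟨x, ⟨-, hx⟩, hxy⟩ := (h n).surjOn ⟨hay, Submodule.smul_mem _ _ hy⟩
      rw [fTilde_pow_apply_primitive hM n (n + 1) hx] at hxy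
      refine ⟨(a : K)⁻¹ • (qFactorial (n + 1))⁻¹ • x,
        Submodule.smul_mem _ _ (Submodule.smul_mem _ _ hx), ?_⟩
      show Uq.f ^ (n + 1) • (a : K)⁻¹ • (qFactorial (n + 1))⁻¹ • x = y
      rw [smul_comm (Uq.f ^ (n + 1)), smul_comm (Uq.f ^ (n + 1)), hxy, inv_smul_smul₀ ha]
  · intro h n
    have hq := qFactorial_ne_zero (n + 1)
    refine ⟨fun x hx => ⟨pow_apply_mem LB.lattice.fTilde_mem _ hx.1, ?_⟩, fun x hx y hy hxy => ?_,
      fun y hy => ?_⟩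
    · rw [fTilde_pow_apply_primitive hM n (n + 1) hx.2]
      exact Submodule.smul_mem _ _ (f_pow_smul_mem_primitiveSpace hM.inI n hx.2)
    · rw [fTilde_pow_apply_primitive hM n (n + 1) hx.2,
        fTilde_pow_apply_primitive hM n (n + 1) hy.2] at hxy
      exact (h n).injOn hx.2 hy.2 (smul_right_injective M (inv_ne_zero hq) hxy)
    · obtain ⟨w, hw, hwy⟩ := (h n).surjOn hy.2
      have hwy' : Uq.f ^ (n + 1) • w = y := hwy
      -- the preimage of `y` is recovered by `e~`, which preserves the lattice
      have he : qFactorial (n + 1) • w ∈ LB.L := by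
        rw [← eTilde_pow_f_pow_smul hM n (n + 1) hw, hwy']
        exact pow_apply_mem LB.lattice.eTilde_mem _ hy.1
      have hwp := Submodule.smul_mem (primitiveSpace M (n : ℤ)) (qFactorial (n + 1)) hw
      refine ⟨_, ⟨he, hwp⟩, ?_⟩
      rw [fTilde_pow_apply_primitive hM n (n + 1) hwp, smul_comm, inv_smul_smul₀ hq, hwy']
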